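/- Let $A\subset\mathbb R$ be an interval, let $\alpha>0$, and let $W\in C^2(A)$ satisfy $W''\ge\alpha$ on $A$. Let $\nu$ denote the measure $e^{-W(x)}\,\mathrm dx$ on $A$ (a finite measure, because of the convexity of $W$). Then for every finite nonnegative Borel measure $\mu$ on $A$, $$\alpha\,\mathcal E(\mu|\nu,A)\;\le\;\mathcal R(\mu|\nu,A).$$ Here, if $\mu$ is absolutely continuous with respect to $\nu$ with density $f$, i.e. $\mu=f\nu$, $$\mathcal E(\mu|\nu,A):=\int_A f\log f\,\mathrm d\nu-\mu(A)\log\frac{\mu(A)}{\nu(A)}\in(-\infty,+\infty],\qquad \mathcal R(\mu|\nu,A):=2\int_A\bigl|\partial_x\sqrt f\,\bigr|^2\,\mathrm d\nu\in[0,+\infty],$$ and $\mathcal E(\mu|\nu,A):=\mathcal R(\mu|\nu,A):=+\infty$ if $\mu$ is not absolutely continuous with respect to $\nu$. The convention $0\log 0=0\log\frac00=0$ is used; $\partial_x\sqrt f$ is the weak (distributional) derivative of $\sqrt f$ in $L^1_{\mathrm{loc}}$ of the interior of $A$, and $\mathcal R(\mu|\nu,A):=+\infty$ if it does not exist. -/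

import Mathlib

open MeasureTheory Set
open scoped ENNReal ContDiff

namespace LocalizedLSI

/-- `g` is the weak (distributional) derivative of `u` on the open set `U ⊆ ℝ`: both functions are
locally Lebesgue integrable on `U`, and `∫ u φ' = - ∫ g φ` for every smooth test function `φ` with
compact support in `U`. -/
def IsWeakDerivOn (u g : ℝ → ℝ) (U : Set ℝ) : Prop :=
  LocallyIntegrableOn u U volume ∧ LocallyIntegrableOn g U volume ∧
    ∀ φ : ℝ → ℝ, ContDiff ℝ ∞ φ → HasCompactSupport φ → tsupport φ ⊆ U →
      ∫ x, u x * deriv φ x = - ∫ x, g x * φ x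

/-- The density `f = dμ/dν`, as a real-valued function. -/
noncomputable def density (μ ν : Measure ℝ) (x : ℝ) : ℝ := (μ.rnDeriv ν x).toReal

/-- The extended integral `∫_A h dν`, as the integral of the positive part minus that of the
negative part. -/
noncomputable def extIntegral (h : ℝ → ℝ) (ν : Measure ℝ) (A : Set ℝ) : EReal :=
  ((∫⁻ x in A, ENNReal.ofReal (h x) ∂ν : ℝ≥0∞) : EReal) -
    ((∫⁻ x in A, ENNReal.ofReal (-h x) ∂ν : ℝ≥0∞) : EReal)

open scoped Classical in
/-- Localized relative entropy of finite measures `μ`, `ν`: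
`∫_A f log f dν - μ(A) log (μ(A) / ν(A))` if `μ ≪ ν` and `μ = f ν`, and `+∞` otherwise.
(`f log f ≥ -1/e`, so for finite `ν` the integral is well defined in `(-∞, +∞]`; the conventions
`0 log 0 = 0` and `0 log (0/0) = 0` are in force.) -/
noncomputable def relEntropy (μ ν : Measure ℝ) (A : Set ℝ) : EReal :=
  if μ ≪ ν then
    extIntegral (fun x => density μ ν x * Real.log (density μ ν x)) ν A
      - ((μ.real A * Real.log (μ.real A / ν.real A) : ℝ) : EReal)
  else ⊤

open scoped Classical in
/-- Localized relative Fisher information: `2 ∫_A |∂ₓ √f|² dν` if `μ ≪ ν` and `μ = f ν`, and `+∞`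
otherwise. Here `∂ₓ √f` is the weak derivative on the interior of `A`, and the value is `+∞` if
there is none. (When `ν` is Lebesgue-absolutely continuous and the boundary of `A` is a null set,
any two weak derivatives give the same integral; the infimum only serves to select that common
value.) -/
noncomputable def relFisher (μ ν : Measure ℝ) (A : Set ℝ) : ℝ≥0∞ :=
  if μ ≪ ν then
    ⨅ (g : ℝ → ℝ) (_ : IsWeakDerivOn (fun x => √(density μ ν x)) g (interior A)),
      2 * ∫⁻ x in A, ENNReal.ofReal (|g x| ^ 2) ∂ν
  else ⊤

/-- The measure `e^{-W} dx` on `A`. -/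
noncomputable def gibbs (W : ℝ → ℝ) (A : Set ℝ) : Measure ℝ :=
  (volume.restrict A).withDensity (fun x => ENNReal.ofReal (Real.exp (-W x)))

end LocalizedLSI

/-! The proof is by optimal transport in dimension one. Put `H = √f` and work on a compact interval
`[a, b]` inside `A`, where `H` has an absolutely continuous representative. Let `M`, `N` be the
masses of `H² e^{-W}` and `e^{-W}` on `[a, b]`, and let `T` be the increasing map carrying the first
density, normalized, to the second. Take logarithms in `T' = (H² e^{-W} / M) / (e^{-W ∘ T} / N)`,
bound `log T' ≤ T' - 1`, and bound `W(T x)` below by the tangent parabola of `W` at `x`. With `θ = T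
x - x` this controls `log H²` by `log (M / N) - W' θ + θ' - (α/2) θ²`. Multiply by `H² e^{-W}`:
completing the square trades the quadratic term for `(2/α) H'²` and a remainder that is exactly the
derivative of `H² e^{-W} θ`. Its integral vanishes because `T` fixes `a` and `b`.

The pointwise estimate is `mul_log_sq_mul_exp_le`, integrated in `logSobolev_Icc_of_pos`. Positivity
of `H` is removed by letting `ε → 0` in `ε + H`, and compact intervals exhaust the interior of `A`,
whose complement in `A` is null. -/

namespace LocalizedLSI

/-! ### Weak derivatives and absolutely continuous representatives. -/

/-- A compact subset of an open interval lies in a closed subinterval. -/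
lemma exists_Icc_of_isCompact_subset_Ioo {a b : ℝ} (hab : a < b) {K : Set ℝ} (hK : IsCompact K)
    (hKab : K ⊆ Ioo a b) : ∃ c d, a < c ∧ c ≤ d ∧ d < b ∧ K ⊆ Icc c d := by
  rcases K.eq_empty_or_nonempty with rfl | hne
  · obtain ⟨c, hc⟩ := exists_between hab
    exact ⟨c, c, hc.1, le_rfl, hc.2, empty_subset _⟩
  · obtain ⟨c, hc, hc'⟩ := hK.exists_isLeast hne
    obtain ⟨d, hd, hd'⟩ := hK.exists_isGreatest hne
    exact ⟨c, d, (hKab hc).1, hc' hd, (hKab hd).2, fun x hx => ⟨hc' hx, hd' hx⟩⟩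

/-- A test function on `(a, b)` of integral zero is the derivative of a test function. -/
lemma exists_test_primitive {a b : ℝ} (hab : a < b) {ξ : ℝ → ℝ} (hξ : ContDiff ℝ ∞ ξ)
    (hc : HasCompactSupport ξ) (hs : tsupport ξ ⊆ Ioo a b) (h0 : ∫ x, ξ x = 0) :
    ∃ Ξ : ℝ → ℝ, ContDiff ℝ ∞ Ξ ∧ HasCompactSupport Ξ ∧ tsupport Ξ ⊆ Ioo a b ∧ deriv Ξ = ξ := by
  obtain ⟨c, d, hac, hcd, hdb, hK⟩ := exists_Icc_of_isCompact_subset_Ioo hab hc hs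
  have hint : Integrable ξ := hξ.continuous.integrable_of_hasCompactSupport hc
  have hz : ∀ x, x ∉ Icc c d → ξ x = 0 := fun x hx =>
    image_eq_zero_of_notMem_tsupport fun h => hx (hK h)
  have hder : ∀ x, HasDerivAt (fun x => ∫ t in Iic x, ξ t) (ξ x) x := by
    intro x
    have h1 : (fun x => ∫ t in Iic x, ξ t) =
        fun x => (∫ t in Iic a, ξ t) + ∫ t in a..x, ξ t := by
      ext y
      rw [← intervalIntegral.integral_Iic_sub_Iic hint.integrableOn hint.integrableOn]
      ring
    rw [h1]
    exact (intervalIntegral.integral_hasDerivAt_right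
      (hξ.continuous.intervalIntegrable _ _)
      (hξ.continuous.stronglyMeasurableAtFilter _ _) hξ.continuous.continuousAt).const_add _
  have hd : deriv (fun x => ∫ t in Iic x, ξ t) = ξ := funext fun x => (hder x).deriv
  -- Left of `c` the integrand vanishes; right of `d` the integral is already the total one, which
  -- is zero.
  have hzero : ∀ x, x ∉ Icc c d → ∫ t in Iic x, ξ t = 0 := by
    intro x hx
    rcases lt_or_ge x c with hxc | hxc
    · exact setIntegral_eq_zero_of_forall_eq_zero fun t ht =>
        hz t fun h => absurd (h.1.trans ht) (not_le.2 hxc)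
    · have hxd : d < x := by
        by_contra h
        exact hx ⟨hxc, not_lt.1 h⟩
      rw [setIntegral_eq_integral_of_forall_compl_eq_zero, h0]
      intro t ht
      exact hz t fun h => ht (h.2.trans hxd.le)
  have hsup : tsupport (fun x => ∫ t in Iic x, ξ t) ⊆ Icc c d :=
    closure_minimal (fun x hx => by
      by_contra h
      exact hx (hzero x h)) isClosed_Icc
  refine ⟨fun x => ∫ t in Iic x, ξ t, ?_, isCompact_Icc.of_isClosed_subset
    (isClosed_tsupport _) hsup, hsup.trans (Icc_subset_Ioo hac hdb), hd⟩
  rw [contDiff_infty_iff_deriv, hd]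
  exact ⟨fun x => (hder x).differentiableAt, hξ⟩

/-- The lemma of du Bois-Reymond: a function with zero weak derivative is constant. -/
lemma ae_eq_const_of_integral_mul_deriv_eq_zero {a b : ℝ} (hab : a < b) {v : ℝ → ℝ}
    (hv : IntegrableOn v (Ioo a b))
    (h : ∀ φ : ℝ → ℝ, ContDiff ℝ ∞ φ → HasCompactSupport φ → tsupport φ ⊆ Ioo a b →
      ∫ x, v x * deriv φ x = 0) :
    ∃ c, ∀ᵐ x, x ∈ Ioo a b → v x = c := by
  let ψ : ContDiffBump ((a + b) / 2) := ⟨(b - a) / 8, (b - a) / 4, by linarith, by linarith⟩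
  have hψs : tsupport (ψ.normed volume) ⊆ Ioo a b := by
    rw [ψ.tsupport_normed_eq, Real.closedBall_eq_Icc]
    apply Icc_subset_Ioo <;> simp only [ψ] <;> linarith
  have hψc : HasCompactSupport (ψ.normed volume) := ψ.hasCompactSupport_normed
  have hψd : ContDiff ℝ ∞ (ψ.normed volume) := ψ.contDiff_normed
  have hvint : ∀ η : ℝ → ℝ, Continuous η → HasCompactSupport η → tsupport η ⊆ Ioo a b →
      Integrable fun x => v x * η x := by
    intro η hη hηc hηs
    obtain ⟨C, hC⟩ := hη.bounded_above_of_compact_support hηc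
    have h1 : IntegrableOn (fun x => v x * η x) (Ioo a b) :=
      Integrable.mul_bdd hv hη.aestronglyMeasurable (Filter.Eventually.of_forall hC)
    refine (integrableOn_iff_integrable_of_support_subset ?_).1 h1
    intro x hx
    apply hηs
    apply subset_tsupport
    intro h0
    exact hx (by simp [h0])
  refine ⟨∫ x, v x * ψ.normed volume x, ?_⟩
  set c := ∫ x, v x * ψ.normed volume x with hcdef
  have key : ∀ᵐ x, x ∈ Ioo a b → v x - c = 0 := by
    apply isOpen_Ioo.ae_eq_zero_of_integral_contDiff_smul_eq_zero
    · exact (hv.sub (integrableOn_const (by simp))).locallyIntegrableOn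
    · intro η hη hηc hηs
      have hηi : Integrable η := hη.continuous.integrable_of_hasCompactSupport hηc
      have hψi : Integrable (ψ.normed volume) := ψ.integrable_normed
      have hsub : tsupport (fun x => η x - (∫ y, η y) * ψ.normed volume x) ⊆ Ioo a b := by
        refine (tsupport_sub η (fun x => (∫ y, η y) * ψ.normed volume x)).trans
          (union_subset hηs ((tsupport_mul_subset_right).trans hψs))
      -- Subtracting `(∫ η) ψ` makes the mean of `η` zero, so that the difference is an admissible
      -- derivative.
      obtain ⟨Ξ, h1, h2, h3, h4⟩ := exists_test_primitive hab
        (ξ := fun x => η x - (∫ y, η y) * ψ.normed volume x)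
        (hη.sub (contDiff_const.mul hψd)) (hηc.sub hψc.mul_left) hsub (by
          rw [integral_sub hηi (hψi.const_mul _), integral_const_mul, ψ.integral_normed]
          simp)
      have h5 := h Ξ h1 h2 h3
      rw [h4] at h5
      have i1 := hvint η hη.continuous hηc hηs
      have i2 := hvint _ hψd.continuous hψc hψs
      have h6 : ∫ x, v x * (η x - (∫ y, η y) * ψ.normed volume x)
          = (∫ x, v x * η x) - (∫ y, η y) * c := by
        rw [hcdef, ← integral_const_mul, ← integral_sub i1 (i2.const_mul _)]
        congr 1
        ext x
        ring
      rw [h6] at h5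
      calc ∫ x, η x • (v x - c) = ∫ x, (v x * η x - c * η x) := by
            congr 1
            ext x
            simp only [smul_eq_mul]
            ring
        _ = (∫ x, v x * η x) - c * ∫ x, η x := by
            rw [integral_sub i1 (hηi.const_mul _), integral_const_mul]
        _ = 0 := by linarith
  filter_upwards [key] with x hx hxm
  linarith [hx hxm]

/-- A function with an integrable weak derivative on `(a, b)` has an absolutely continuous
representative. -/
lemma ae_eq_const_add_integral {a b : ℝ} (hab : a < b) {u g : ℝ → ℝ}
    (hu : IntegrableOn u (Ioo a b)) (hg : IntervalIntegrable g volume a b)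
    (h : ∀ φ : ℝ → ℝ, ContDiff ℝ ∞ φ → HasCompactSupport φ → tsupport φ ⊆ Ioo a b →
      ∫ x, u x * deriv φ x = - ∫ x, g x * φ x) :
    ∃ c, ∀ᵐ x, x ∈ Ioo a b → u x = c + ∫ t in a..x, g t := by
  have hAC : AbsolutelyContinuousOnInterval (fun x => ∫ t in a..x, g t) a b :=
    hg.absolutelyContinuousOnInterval_intervalIntegral (by simp)
  have hGi : IntegrableOn (fun x => ∫ t in a..x, g t) (Ioo a b) := by
    have := hAC.continuousOn
    rw [uIcc_of_le hab.le] at this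
    exact this.integrableOn_Icc.mono_set Ioo_subset_Icc_self
  obtain ⟨c, hc⟩ := ae_eq_const_of_integral_mul_deriv_eq_zero hab
    (v := fun x => u x - ∫ t in a..x, g t) (hu.sub hGi) (by
    intro φ hφ hφc hφs
    have hout : ∀ x, x ∉ Ioo a b → φ x = 0 := fun x hx =>
      image_eq_zero_of_notMem_tsupport fun h => hx (hφs h)
    have hout' : ∀ x, x ∉ Ioo a b → deriv φ x = 0 := fun x hx =>
      image_eq_zero_of_notMem_tsupport fun h => hx (hφs (tsupport_deriv_subset h))
    have hφAC : AbsolutelyContinuousOnInterval φ a b := by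
      obtain ⟨C, hC⟩ := (hφ.of_le (by simp) : ContDiff ℝ 1 φ).lipschitzWith_of_hasCompactSupport
        hφc (by simp)
      exact hC.lipschitzOnWith.absolutelyContinuousOnInterval
    have hd : Continuous (deriv φ) := hφ.continuous_deriv (by simp)
    obtain ⟨C, hC⟩ := hd.bounded_above_of_compact_support hφc.deriv
    have hIoo : ∀ w : ℝ → ℝ, ∫ x in Ioo a b, w x * deriv φ x = ∫ x, w x * deriv φ x := fun w =>
      setIntegral_eq_integral_of_forall_compl_eq_zero fun x hx => by rw [hout' x hx, mul_zero]
    have hmul : ∀ w : ℝ → ℝ, IntegrableOn w (Ioo a b) →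
        IntegrableOn (fun x => w x * deriv φ x) (Ioo a b) := fun w hw =>
      Integrable.mul_bdd hw hd.aestronglyMeasurable (Filter.Eventually.of_forall hC)
    -- Integration by parts shows that the primitive of `g` has weak derivative `g`, so `u` minus it
    -- has weak derivative zero.
    have hparts := hAC.integral_mul_deriv_eq_deriv_mul hφAC
    rw [hout a (by simp), hout b (by simp), mul_zero, mul_zero, sub_zero, zero_sub] at hparts
    have hg' : ∫ x in a..b, deriv (fun x => ∫ t in a..x, g t) x * φ x = ∫ x, g x * φ x := by
      rw [← setIntegral_eq_integral_of_forall_compl_eq_zero (s := Ioo a b)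
        (f := fun x => g x * φ x) (fun x hx => by rw [hout x hx, mul_zero]),
        ← integral_Ioc_eq_integral_Ioo, ← intervalIntegral.integral_of_le hab.le]
      apply intervalIntegral.integral_congr_ae
      filter_upwards [hg.ae_hasDerivAt_integral] with x hx hxm
      rw [(hx (uIoc_subset_uIcc hxm) a (by simp)).deriv]
    rw [← hIoo]
    simp only [sub_mul]
    rw [integral_sub (hmul _ hu) (hmul _ hGi), hIoo, h φ hφ hφc hφs,
      ← integral_Ioc_eq_integral_Ioo, ← intervalIntegral.integral_of_le hab.le, hparts, hg']
    ring)
  refine ⟨c, ?_⟩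
  filter_upwards [hc] with x hx hxm
  linarith [hx hxm]

/-! ### Monotone transport between positive densities. -/

/-- Freezing `w` at its endpoint values outside `[a, b]` adds no new values, so bounds survive.
Densities then live on all of `ℝ`, and the transport map needs no one-sided derivatives. -/
lemma exists_continuous_extension {a b : ℝ} (hab : a ≤ b) {w : ℝ → ℝ}
    (hw : ContinuousOn w (Icc a b)) :
    ∃ p : ℝ → ℝ, Continuous p ∧ EqOn p w (Icc a b) ∧ ∀ x, ∃ y ∈ Icc a b, p x = w y :=
  ⟨fun x => w (projIcc a b hab x),
    hw.comp_continuous (continuous_subtype_val.comp continuous_projIcc) fun x =>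
      (projIcc a b hab x).2,
    fun x hx => by simp only [projIcc_of_mem hab hx],
    fun x => ⟨projIcc a b hab x, (projIcc a b hab x).2, rfl⟩⟩

lemma exists_continuous_pos_extension {a b : ℝ} (hab : a ≤ b) {w : ℝ → ℝ}
    (hw : ContinuousOn w (Icc a b)) (hpos : ∀ x ∈ Icc a b, 0 < w x) :
    ∃ p : ℝ → ℝ, Continuous p ∧ EqOn p w (Icc a b) ∧ ∃ m > 0, ∀ x, m ≤ p x := by
  obtain ⟨p, hp, he, hr⟩ := exists_continuous_extension hab hw
  obtain ⟨z, hz, hmin⟩ := isCompact_Icc.exists_isMinOn (nonempty_Icc.2 hab) hw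
  refine ⟨p, hp, he, w z, hpos z hz, fun x => ?_⟩
  obtain ⟨y, hy, hxy⟩ := hr x
  rw [hxy]
  exact hmin hy

lemma hasDerivAt_primitive {q : ℝ → ℝ} (hq : Continuous q) (a x : ℝ) :
    HasDerivAt (fun x => ∫ t in a..x, q t) (q x) x :=
  intervalIntegral.integral_hasDerivAt_right (hq.intervalIntegrable _ _)
    (hq.stronglyMeasurableAtFilter _ _) hq.continuousAt

/-- The lower bound `m` forces at least linear growth in both directions. -/
lemma surjective_primitive {q : ℝ → ℝ} (hq : Continuous q) {m : ℝ} (hm : 0 < m)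
    (hmq : ∀ x, m ≤ q x) (a : ℝ) : Function.Surjective fun x => ∫ t in a..x, q t := by
  have hint : ∀ x y, IntervalIntegrable q volume x y := fun x y => hq.intervalIntegrable _ _
  have hlow : ∀ x y, x ≤ y → m * (y - x) ≤ ∫ t in x..y, q t := by
    intro x y hxy
    have := intervalIntegral.integral_mono_on hxy (intervalIntegrable_const (c := m)) (hint x y)
      fun t _ => hmq t
    rw [intervalIntegral.integral_const, smul_eq_mul] at this
    linarith
  apply Continuous.surjective
  · exact continuous_iff_continuousAt.2 fun x => (hasDerivAt_primitive hq a x).continuousAt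
  · apply Filter.tendsto_atTop_mono' _ _
      ((Filter.tendsto_atTop_add_const_right _ (-a) Filter.tendsto_id).const_mul_atTop hm)
    filter_upwards [Filter.eventually_ge_atTop a] with x hx
    exact hlow a x hx
  · apply Filter.tendsto_atBot_mono' _ _
      ((Filter.tendsto_atBot_add_const_right _ (-a) Filter.tendsto_id).const_mul_atBot hm)
    filter_upwards [Filter.eventually_le_atBot a] with x hx
    have := hlow x a hx
    rw [intervalIntegral.integral_symm]
    simp only [id]
    linarith

/-- The monotone transport map between two densities of equal mass on `[a, b]`. -/
lemma exists_monotone_transport {a b : ℝ} {p q : ℝ → ℝ} (hp : Continuous p)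
    (hq : Continuous q) (hp0 : ∀ x, 0 < p x) {m : ℝ} (hm : 0 < m) (hmq : ∀ x, m ≤ q x)
    (hpq : ∫ x in a..b, p x = ∫ x in a..b, q x) :
    ∃ T : ℝ → ℝ, StrictMono T ∧ T a = a ∧ T b = b ∧
      ∀ x, HasDerivAt T (p x / q (T x)) x := by
  have hq0 : ∀ x, 0 < q x := fun x => hm.trans_le (hmq x)
  have hG : ∀ x, HasDerivAt (fun x => ∫ t in a..x, q t) (q x) x := hasDerivAt_primitive hq a
  have hF : ∀ x, HasDerivAt (fun x => ∫ t in a..x, p t) (p x) x := hasDerivAt_primitive hp a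
  have hGm : StrictMono fun x => ∫ t in a..x, q t :=
    strictMono_of_deriv_pos fun x => by rw [(hG x).deriv]; exact hq0 x
  have hFm : StrictMono fun x => ∫ t in a..x, p t :=
    strictMono_of_deriv_pos fun x => by rw [(hF x).deriv]; exact hp0 x
  -- With `F`, `G` the primitives of `p`, `q` from `a`, the transport map is `G⁻¹ ∘ F`.
  let e := hGm.orderIsoOfSurjective _ (surjective_primitive hq hm hmq a)
  have he : ∀ x, e x = ∫ t in a..x, q t := fun x => rfl
  have hes : ∀ y, HasDerivAt e.symm (q (e.symm y))⁻¹ y := fun y =>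
    HasDerivAt.of_local_left_inverse (f := e) e.symm.continuous.continuousAt (hG _) (hq0 _).ne'
      (Filter.Eventually.of_forall fun z => e.apply_symm_apply z)
  refine ⟨fun x => e.symm (∫ t in a..x, p t), e.symm.strictMono.comp hFm, ?_, ?_, fun x => ?_⟩
  · rw [OrderIso.symm_apply_eq, he]
    simp
  · rw [OrderIso.symm_apply_eq, he, hpq]
  · have := (hes _).comp x (hF x)
    rw [div_eq_inv_mul]
    exact this

/-! ### The logarithmic Sobolev inequality on a compact interval. -/

lemma absolutelyContinuousOnInterval_of_hasDerivAt {a b : ℝ} {k k' : ℝ → ℝ}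
    (hk : ∀ x ∈ uIcc a b, HasDerivAt k (k' x) x) (hk' : ContinuousOn k' (uIcc a b)) :
    AbsolutelyContinuousOnInterval k a b := by
  obtain ⟨C, hC⟩ := isCompact_uIcc.exists_bound_of_continuousOn hk'
  refine LipschitzOnWith.absolutelyContinuousOnInterval (K := C.toNNReal)
    ((convex_uIcc a b).lipschitzOnWith_of_nnnorm_hasDerivWithin_le
      (fun x hx => (hk x hx).hasDerivWithinAt) fun x hx => ?_)
  rw [← NNReal.coe_le_coe, coe_nnnorm]
  exact (hC x hx).trans (Real.le_coe_toNNReal C)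

/-- The pointwise form of the transport inequality. -/
lemma mul_log_sq_mul_exp_le {α h g w w' wT θ θ' c M N : ℝ} (hα : 0 < α) (hh : 0 < h)
    (hM : 0 < M) (hN : 0 < N) (hc : c = M / N)
    (hconv : w + w' * θ + α / 2 * θ ^ 2 ≤ wT)
    (hMA : θ' + 1 = (h ^ 2 * Real.exp (-w) / M) / (Real.exp (-wT) / N)) :
    h ^ 2 * Real.log (h ^ 2) * Real.exp (-w) ≤
      Real.log c * (h ^ 2 * Real.exp (-w))
        + (2 * h * g * (Real.exp (-w) * θ)
          + h ^ 2 * (Real.exp (-w) * (-w') * θ + Real.exp (-w) * θ'))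
        + 2 / α * (g ^ 2 * Real.exp (-w)) := by
  -- Here `w = W x`, `wT = W (T x)`, `θ = T x - x` and `θ' = T' x - 1`.
  have hpos : 0 < θ' + 1 := by rw [hMA]; positivity
  have hlog : Real.log (θ' + 1) = Real.log (h ^ 2) - w - Real.log c + wT := by
    rw [hMA, hc, Real.log_div (by positivity) (by positivity),
      Real.log_div (by positivity) (by positivity), Real.log_div (by positivity) (by positivity),
      Real.log_mul (by positivity) (by positivity), Real.log_div (by positivity) (by positivity),
      Real.log_exp, Real.log_exp]
    ring
  have hle : Real.log (θ' + 1) ≤ θ' := by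
    have := Real.log_le_sub_one_of_pos hpos
    linarith
  have h1 : Real.log (h ^ 2) ≤ Real.log c - w' * θ - α / 2 * θ ^ 2 + θ' := by linarith
  have h2 : h ^ 2 * Real.log (h ^ 2) ≤
      h ^ 2 * (Real.log c - w' * θ - α / 2 * θ ^ 2 + θ') :=
    mul_le_mul_of_nonneg_left h1 (by positivity)
  -- This square absorbs `-(α/2) h² θ²` and is the source of the constant `2 / α`.
  have h3 : 0 ≤ α / 2 * (h * θ + 2 * g / α) ^ 2 := by positivity
  have h4 : α / 2 * (h * θ + 2 * g / α) ^ 2 =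
      α / 2 * h ^ 2 * θ ^ 2 + 2 * h * g * θ + 2 / α * g ^ 2 := by
    field_simp
    ring
  rw [h4] at h3
  have h5 : h ^ 2 * Real.log (h ^ 2) ≤ Real.log c * h ^ 2 + (2 * h * g * θ
      + h ^ 2 * (-w' * θ + θ')) + 2 / α * g ^ 2 := by linarith
  have h6 := mul_le_mul_of_nonneg_right h5 (Real.exp_pos (-w)).le
  linarith

/-- The logarithmic Sobolev inequality on a compact interval, for a positive absolutely continuous
square root of the density. -/
lemma logSobolev_Icc_of_pos {a b α : ℝ} (hab : a < b) (hα : 0 < α) {W W' H g : ℝ → ℝ}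
    (hW : ∀ x ∈ Icc a b, HasDerivAt W (W' x) x) (hW' : ContinuousOn W' (Icc a b))
    (hconv : ∀ x ∈ Icc a b, ∀ y ∈ Icc a b, W x + W' x * (y - x) + α / 2 * (y - x) ^ 2 ≤ W y)
    (hH : AbsolutelyContinuousOnInterval H a b)
    (hHg : ∀ᵐ x, x ∈ Icc a b → HasDerivAt H (g x) x)
    (hpos : ∀ x ∈ Icc a b, 0 < H x)
    (hg : IntervalIntegrable (fun x => g x ^ 2 * Real.exp (-W x)) volume a b) :
    ∫ x in a..b, H x ^ 2 * Real.log (H x ^ 2) * Real.exp (-W x) ≤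
      (∫ x in a..b, H x ^ 2 * Real.exp (-W x)) *
        Real.log ((∫ x in a..b, H x ^ 2 * Real.exp (-W x)) / ∫ x in a..b, Real.exp (-W x))
      + 2 / α * ∫ x in a..b, g x ^ 2 * Real.exp (-W x) := by
  have huI : uIcc a b = Icc a b := uIcc_of_le hab.le
  have hHc : ContinuousOn H (Icc a b) := huI ▸ hH.continuousOn
  have hWc : ContinuousOn W (Icc a b) := fun x hx => (hW x hx).continuousAt.continuousWithinAt
  have hEc : ContinuousOn (fun x => Real.exp (-W x)) (Icc a b) := hWc.neg.rexp
  have hPc : ContinuousOn (fun x => H x ^ 2 * Real.exp (-W x)) (Icc a b) := (hHc.pow 2).mul hEc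
  set M := ∫ x in a..b, H x ^ 2 * Real.exp (-W x) with hMdef
  set N := ∫ x in a..b, Real.exp (-W x) with hNdef
  have hii : ∀ {w : ℝ → ℝ}, ContinuousOn w (Icc a b) → IntervalIntegrable w volume a b :=
    fun hw => (huI.symm ▸ hw).intervalIntegrable
  have hM : 0 < M := intervalIntegral.intervalIntegral_pos_of_pos_on (hii hPc)
    (fun x hx => mul_pos (pow_pos (hpos x (Ioo_subset_Icc_self hx)) 2) (Real.exp_pos _)) hab
  have hN : 0 < N := intervalIntegral.intervalIntegral_pos_of_pos_on (hii hEc)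
    (fun x _ => Real.exp_pos _) hab
  obtain ⟨p, hp, hpe, mp, hmp, hmp'⟩ := exists_continuous_pos_extension hab.le
    (hPc.div_const M) fun x hx =>
      div_pos (mul_pos (pow_pos (hpos x hx) 2) (Real.exp_pos _)) hM
  obtain ⟨q, hq, hqe, mq, hmq, hmq'⟩ := exists_continuous_pos_extension hab.le
    (hEc.div_const N) fun x hx => div_pos (Real.exp_pos _) hN
  have hpint : ∫ x in a..b, p x = 1 := by
    rw [intervalIntegral.integral_congr (g := fun x => H x ^ 2 * Real.exp (-W x) / M)
      (huI.symm ▸ hpe), intervalIntegral.integral_div, ← hMdef, div_self hM.ne']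
  have hqint : ∫ x in a..b, q x = 1 := by
    rw [intervalIntegral.integral_congr (g := fun x => Real.exp (-W x) / N)
      (huI.symm ▸ hqe), intervalIntegral.integral_div, ← hNdef, div_self hN.ne']
  obtain ⟨T, hTm, hTa, hTb, hT⟩ := exists_monotone_transport hp hq
    (fun x => hmp.trans_le (hmp' x)) hmq hmq' (hpint.trans hqint.symm)
  have hTI : ∀ x ∈ Icc a b, T x ∈ Icc a b := fun x hx =>
    ⟨hTa ▸ hTm.monotone hx.1, hTb ▸ hTm.monotone hx.2⟩
  have hTc : Continuous T := continuous_iff_continuousAt.2 fun x => (hT x).continuousAt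
  have hT'c : Continuous fun x => p x / q (T x) :=
    hp.div (hq.comp hTc) fun x => (hmq.trans_le (hmq' _)).ne'
  have hk : ∀ x ∈ Icc a b, HasDerivAt (fun x => Real.exp (-W x) * (T x - x))
      (Real.exp (-W x) * (-W' x) * (T x - x) + Real.exp (-W x) * (p x / q (T x) - 1)) x :=
    fun x hx => (hW x hx).fun_neg.exp.fun_mul ((hT x).fun_sub (hasDerivAt_id' x))
  have hkAC : AbsolutelyContinuousOnInterval (fun x => Real.exp (-W x) * (T x - x)) a b := by
    refine absolutelyContinuousOnInterval_of_hasDerivAt (huI.symm ▸ hk) (huI.symm ▸ ?_)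
    exact ((hEc.mul hW'.neg).mul (hTc.sub continuous_id).continuousOn).add
      (hEc.mul (hT'c.sub continuous_const).continuousOn)
  -- Absolute continuity is what allows the total derivative to be integrated, `H` being
  -- differentiable only almost everywhere.
  have hΦAC : AbsolutelyContinuousOnInterval
      (fun x => (H x * H x) * (Real.exp (-W x) * (T x - x))) a b := (hH.mul hH).mul hkAC
  have hΦint := hΦAC.integral_deriv_eq_sub
  simp only [hTa, hTb, sub_self, mul_zero] at hΦint
  have hΦii := hΦAC.intervalIntegrable_deriv
  have hae : ∀ᵐ x ∂(volume.restrict (Icc a b)),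
      H x ^ 2 * Real.log (H x ^ 2) * Real.exp (-W x) ≤
        Real.log (M / N) * (H x ^ 2 * Real.exp (-W x))
        + deriv (fun x => (H x * H x) * (Real.exp (-W x) * (T x - x))) x
        + 2 / α * (g x ^ 2 * Real.exp (-W x)) := by
    rw [ae_restrict_iff' measurableSet_Icc]
    filter_upwards [hHg] with x hx hxI
    have hd := (((hx hxI).fun_mul (hx hxI)).fun_mul (hk x hxI)).deriv
    rw [hd]
    have := mul_log_sq_mul_exp_le (g := g x) (θ := T x - x) (θ' := p x / q (T x) - 1) hα
      (hpos x hxI) hM hN rfl (hconv x hxI (T x) (hTI x hxI)) (by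
        rw [sub_add_cancel, hpe hxI, hqe (hTI x hxI)])
    linarith
  have hlogc : ContinuousOn (fun x => H x ^ 2 * Real.log (H x ^ 2) * Real.exp (-W x))
      (Icc a b) := (Real.continuous_mul_log.comp_continuousOn (hHc.pow 2)).mul hEc
  have i1 : IntervalIntegrable (fun x => Real.log (M / N) * (H x ^ 2 * Real.exp (-W x)))
      volume a b := (hii hPc).const_mul _
  have i2 := hg.const_mul (2 / α)
  calc _ ≤ ∫ x in a..b, (Real.log (M / N) * (H x ^ 2 * Real.exp (-W x))
        + deriv (fun x => (H x * H x) * (Real.exp (-W x) * (T x - x))) x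
        + 2 / α * (g x ^ 2 * Real.exp (-W x))) :=
        intervalIntegral.integral_mono_ae_restrict hab.le (hii hlogc) ((i1.add hΦii).add i2) hae
    _ = _ := by
        rw [intervalIntegral.integral_add (i1.add hΦii) i2, intervalIntegral.integral_add i1 hΦii,
          hΦint, intervalIntegral.integral_const_mul, intervalIntegral.integral_const_mul]
        ring

/-- After extension to `ℝ` the integrand is jointly continuous in `ε` and `x`. -/
lemma continuous_integral_comp_const_add {a b : ℝ} (hab : a ≤ b) {H E k : ℝ → ℝ}
    (hH : ContinuousOn H (Icc a b)) (hE : ContinuousOn E (Icc a b)) (hk : Continuous k) :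
    Continuous fun ε : ℝ => ∫ x in a..b, k (ε + H x) * E x := by
  obtain ⟨H', hH', hHe, -⟩ := exists_continuous_extension hab hH
  obtain ⟨E', hE', hEe, -⟩ := exists_continuous_extension hab hE
  have : (fun ε : ℝ => ∫ x in a..b, k (ε + H x) * E x) =
      fun ε : ℝ => ∫ x in a..b, k (ε + H' x) * E' x := by
    ext ε
    apply intervalIntegral.integral_congr
    intro x hx
    rw [uIcc_of_le hab] at hx
    simp only [hHe hx, hEe hx]
  rw [this]
  apply intervalIntegral.continuous_parametric_intervalIntegral_of_continuous'
  fun_prop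

/-- The right side uses the continuous function `t log t`, so limits remain valid when `M` tends to
zero. -/
lemma mul_log_div_eq {M N : ℝ} (hN : N ≠ 0) :
    M * Real.log (M / N) = N * ((M / N) * Real.log (M / N)) := by
  field_simp

/-- The logarithmic Sobolev inequality on a compact interval, for an absolutely continuous
square root of the density. -/
lemma logSobolev_Icc {a b α : ℝ} (hab : a < b) (hα : 0 < α) {W W' H g : ℝ → ℝ}
    (hW : ∀ x ∈ Icc a b, HasDerivAt W (W' x) x) (hW' : ContinuousOn W' (Icc a b))
    (hconv : ∀ x ∈ Icc a b, ∀ y ∈ Icc a b, W x + W' x * (y - x) + α / 2 * (y - x) ^ 2 ≤ W y)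
    (hH : AbsolutelyContinuousOnInterval H a b)
    (hHg : ∀ᵐ x, x ∈ Icc a b → HasDerivAt H (g x) x)
    (hnn : ∀ x ∈ Icc a b, 0 ≤ H x)
    (hg : IntervalIntegrable (fun x => g x ^ 2 * Real.exp (-W x)) volume a b) :
    ∫ x in a..b, H x ^ 2 * Real.log (H x ^ 2) * Real.exp (-W x) ≤
      (∫ x in a..b, H x ^ 2 * Real.exp (-W x)) *
        Real.log ((∫ x in a..b, H x ^ 2 * Real.exp (-W x)) / ∫ x in a..b, Real.exp (-W x))
      + 2 / α * ∫ x in a..b, g x ^ 2 * Real.exp (-W x) := by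
  have huI : uIcc a b = Icc a b := uIcc_of_le hab.le
  have hHc : ContinuousOn H (Icc a b) := huI ▸ hH.continuousOn
  have hWc : ContinuousOn W (Icc a b) := fun x hx => (hW x hx).continuousAt.continuousWithinAt
  have hEc : ContinuousOn (fun x => Real.exp (-W x)) (Icc a b) := hWc.neg.rexp
  have hN : 0 < ∫ x in a..b, Real.exp (-W x) := intervalIntegral.intervalIntegral_pos_of_pos_on
    ((huI.symm ▸ hEc).intervalIntegrable) (fun x _ => Real.exp_pos _) hab
  have hL := continuous_integral_comp_const_add hab.le hHc hEc
    (k := fun t => t ^ 2 * Real.log (t ^ 2)) (Real.continuous_mul_log.comp (continuous_pow 2))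
  have hM := continuous_integral_comp_const_add hab.le hHc hEc
    (k := fun t => t ^ 2) (continuous_pow 2)
  have hR : Continuous fun ε : ℝ => (∫ x in a..b, (ε + H x) ^ 2 * Real.exp (-W x)) *
      Real.log ((∫ x in a..b, (ε + H x) ^ 2 * Real.exp (-W x)) / ∫ x in a..b, Real.exp (-W x))
      + 2 / α * ∫ x in a..b, g x ^ 2 * Real.exp (-W x) := by
    simp only [mul_log_div_eq hN.ne']
    exact (continuous_const.mul (Real.continuous_mul_log.comp (hM.div_const _))).add
      continuous_const
  -- Adding a constant to the square root, not to the density, leaves the Fisher term unchanged.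
  have key : ∀ ε ∈ Ioi (0 : ℝ), _ ≤ _ := fun ε hε => logSobolev_Icc_of_pos hab hα hW hW' hconv
    (H := fun x => ε + H x) (g := g)
    ((LipschitzWith.const ε).lipschitzOnWith.absolutelyContinuousOnInterval.add hH)
    (by filter_upwards [hHg] with x hx hxI using (hx hxI).const_add ε)
    (fun x hx => add_pos_of_pos_of_nonneg hε (hnn x hx)) hg
  have := le_of_tendsto_of_tendsto ((hL.tendsto 0).mono_left nhdsWithin_le_nhds)
    ((hR.tendsto 0).mono_left nhdsWithin_le_nhds)
    (Filter.eventually_of_mem (self_mem_nhdsWithin (s := Ioi (0 : ℝ))) key)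
  simpa only [zero_add] using this

/-! ### The convex potential and its Gibbs measure. -/

section Potential

variable {A : Set ℝ} {W : ℝ → ℝ} {α : ℝ}

lemma hasDerivAt_of_contDiffOn (hW : ContDiffOn ℝ 2 W A) {x : ℝ} (hx : x ∈ interior A) :
    HasDerivAt W (deriv W x) x :=
  ((hW.differentiableOn (by simp)).differentiableAt (mem_interior_iff_mem_nhds.1 hx)).hasDerivAt

/-- At an interior point `A` is a neighbourhood, so the hypothesis on `W''` concerns ordinary
derivatives there. -/
lemma iteratedDerivWithin_eq_iterate_deriv {x : ℝ} (n : ℕ) (hx : x ∈ interior A) :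
    iteratedDerivWithin n W A x = deriv^[n] W x := by
  rw [← iteratedDeriv_eq_iterate, ← iteratedDerivWithin_univ, iteratedDerivWithin,
    iteratedDerivWithin, iteratedFDerivWithin_congr_set
      (Filter.eventuallyEq_univ.2 (mem_interior_iff_mem_nhds.1 hx))]

/-- A function with second derivative at least `α` lies above its tangent parabolas. -/
lemma tangent_parabola_le (hA : A.OrdConnected) (hW : ContDiffOn ℝ 2 W A)
    (hconv : ∀ x ∈ A, α ≤ iteratedDerivWithin 2 W A x) {x y : ℝ} (hx : x ∈ interior A)
    (hy : y ∈ interior A) : W x + deriv W x * (y - x) + α / 2 * (y - x) ^ 2 ≤ W y := by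
  have hWi := hW.mono interior_subset
  have hI := isOpen_interior (s := A)
  have hd : ∀ z ∈ interior A, HasDerivAt W (deriv W z) z := fun z hz =>
    hasDerivAt_of_contDiffOn hW hz
  have hd2 : ∀ z ∈ interior A, HasDerivAt (deriv W) (deriv^[2] W z) z := by
    intro z hz
    have h1 : ContDiffOn ℝ 1 (deriv W) (interior A) := hWi.deriv_of_isOpen hI (by norm_num)
    exact ((h1.differentiableOn (by simp)).differentiableAt (hI.mem_nhds hz)).hasDerivAt
  -- `V'' = W'' - α ≥ 0`, and `V` has the same value and slope as `W` at `x`; its tangent line at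
  -- `x` is the required parabola.
  set V : ℝ → ℝ := fun z => W z - α / 2 * (z - x) ^ 2 with hV
  have hVd : ∀ z ∈ interior A, HasDerivAt V (deriv W z - α * (z - x)) z := by
    intro z hz
    have := (hd z hz).fun_sub ((((hasDerivAt_id' z).sub_const x).fun_pow 2).const_mul (α / 2))
    refine this.congr_deriv ?_
    push_cast
    ring
  have hVe : ∀ z ∈ interior A, deriv V =ᶠ[nhds z] fun z => deriv W z - α * (z - x) :=
    fun z hz => Filter.eventually_of_mem (hI.mem_nhds hz) fun w hw => (hVd w hw).deriv
  have hVd2 : ∀ z ∈ interior A, HasDerivAt (deriv V) (deriv^[2] W z - α) z := by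
    intro z hz
    have := (hd2 z hz).fun_sub (((hasDerivAt_id' z).sub_const x).const_mul α)
    rw [mul_one] at this
    exact this.congr_of_eventuallyEq (hVe z hz)
  have hVc : ConvexOn ℝ (interior A) V := by
    refine convexOn_of_deriv2_nonneg' hA.convex.interior
      (fun z hz => (hVd z hz).differentiableAt.differentiableWithinAt)
      (fun z hz => (hVd2 z hz).differentiableAt.differentiableWithinAt) fun z hz => ?_
    have h1 := hconv z (interior_subset hz)
    rw [iteratedDerivWithin_eq_iterate_deriv 2 hz] at h1
    have h2 : deriv^[2] V z = deriv^[2] W z - α := (hVd2 z hz).deriv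
    linarith
  have hVx := hVd x hx
  rw [sub_self, mul_zero, sub_zero] at hVx
  have hVxx : V x = W x := by simp [hV]
  have hVy : V y = W y - α / 2 * (y - x) ^ 2 := rfl
  rcases lt_trichotomy x y with h | h | h
  · have := hVc.le_slope_of_hasDerivAt hx hy h hVx
    rw [slope_def_field, le_div_iff₀ (sub_pos.2 h)] at this
    linarith
  · subst h
    simp
  · have := hVc.slope_le_of_hasDerivAt hy hx h hVx
    rw [slope_def_field, div_le_iff₀ (sub_pos.2 h)] at this
    linarith

lemma aemeasurable_exp_neg (hW : ContDiffOn ℝ 2 W A) {s : Set ℝ} (hs : MeasurableSet s)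
    (hsA : s ⊆ A) :
    AEMeasurable (fun x => ENNReal.ofReal (Real.exp (-W x))) (volume.restrict s) :=
  ((hW.continuousOn.mono hsA).neg.rexp.aemeasurable hs).ennreal_ofReal

lemma volume_sdiff_interior (hA : A.OrdConnected) : volume (A \ interior A) = 0 :=
  measure_mono_null (sdiff_subset_sdiff_left subset_closure) (hA.convex.addHaar_frontier volume)

lemma gibbs_absolutelyContinuous : gibbs W A ≪ volume :=
  (withDensity_absolutelyContinuous _ _).trans Measure.restrict_le_self.absolutelyContinuous

lemma restrict_absolutelyContinuous_gibbs (hA : A.OrdConnected) (hW : ContDiffOn ℝ 2 W A) :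
    volume.restrict A ≪ gibbs W A :=
  withDensity_absolutelyContinuous' (aemeasurable_exp_neg hW hA.measurableSet Subset.rfl)
    (Filter.Eventually.of_forall fun x => by simp [Real.exp_pos])

lemma isFiniteMeasure_gibbs (hA : A.OrdConnected) (hW : ContDiffOn ℝ 2 W A) (hα : 0 < α)
    (hconv : ∀ x ∈ A, α ≤ iteratedDerivWithin 2 W A x) : IsFiniteMeasure (gibbs W A) := by
  refine isFiniteMeasure_withDensity_ofReal ?_
  refine Integrable.hasFiniteIntegral ?_
  rcases (interior A).eq_empty_or_nonempty with he | ⟨z, hz⟩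
  · have : volume A = 0 := by simpa [he] using volume_sdiff_interior hA
    rw [Measure.restrict_eq_zero.2 this]
    exact integrable_zero_measure
  set d := deriv W z
  -- The tangent parabola at `z` has a linear term `d (x - z)`; half of the quadratic term absorbs
  -- it at the cost `d² / α`.
  have hgauss : Integrable fun x : ℝ => Real.exp (-W z + d ^ 2 / α) *
      Real.exp (-(α / 4) * (x - z) ^ 2) :=
    ((integrable_exp_neg_mul_sq (by positivity : 0 < α / 4)).comp_sub_right z).const_mul _
  refine Integrable.mono hgauss.integrableOn
    (hW.continuousOn.neg.rexp.aestronglyMeasurable hA.measurableSet) ?_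
  rw [ae_restrict_iff' hA.measurableSet]
  filter_upwards [measure_eq_zero_iff_ae_notMem.1 (volume_sdiff_interior hA)] with x hx hxA
  have hxI : x ∈ interior A := by
    by_contra h
    exact hx ⟨hxA, h⟩
  rw [← Real.exp_add, Real.norm_of_nonneg (Real.exp_pos _).le,
    Real.norm_of_nonneg (Real.exp_pos _).le, Real.exp_le_exp]
  have h1 := tangent_parabola_le hA hW hconv hz hxI
  have h2 : 0 ≤ α / 4 * ((x - z) + 2 * d / α) ^ 2 := by positivity
  have h3 : α / 4 * ((x - z) + 2 * d / α) ^ 2 =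
      α / 4 * (x - z) ^ 2 + d * (x - z) + d ^ 2 / α := by
    field_simp
    ring
  linarith

lemma gibbs_restrict {s : Set ℝ} (hs : MeasurableSet s) (hsA : s ⊆ A) :
    (gibbs W A).restrict s =
      (volume.restrict s).withDensity fun x => ENNReal.ofReal (Real.exp (-W x)) := by
  rw [gibbs, restrict_withDensity hs, Measure.restrict_restrict hs, inter_eq_left.2 hsA]

lemma setIntegral_gibbs (hW : ContDiffOn ℝ 2 W A) {s : Set ℝ} (hs : MeasurableSet s)
    (hsA : s ⊆ A) (F : ℝ → ℝ) :
    ∫ x in s, F x ∂(gibbs W A) = ∫ x in s, F x * Real.exp (-W x) := by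
  rw [gibbs_restrict hs hsA, integral_withDensity_eq_integral_toReal_smul₀
    (aemeasurable_exp_neg hW hs hsA)
    (Filter.Eventually.of_forall fun x => ENNReal.ofReal_lt_top)]
  simp only [ENNReal.toReal_ofReal (Real.exp_pos _).le, smul_eq_mul, mul_comm]

lemma integrableOn_gibbs_iff (hW : ContDiffOn ℝ 2 W A) {s : Set ℝ} (hs : MeasurableSet s)
    (hsA : s ⊆ A) {F : ℝ → ℝ} :
    IntegrableOn F s (gibbs W A) ↔ IntegrableOn (fun x => F x * Real.exp (-W x)) s := by
  rw [IntegrableOn, gibbs_restrict hs hsA, integrable_withDensity_iff_integrable_smul₀'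
    (aemeasurable_exp_neg hW hs hsA)
    (Filter.Eventually.of_forall fun x => ENNReal.ofReal_lt_top)]
  simp only [ENNReal.toReal_ofReal (Real.exp_pos _).le, smul_eq_mul, mul_comm, IntegrableOn]

end Potential

/-! ### From compact subintervals to the whole of `A`. -/

/-- A nonempty open interval is exhausted by compact intervals. -/
lemma exists_Icc_exhaustion {I : Set ℝ} (hI : IsOpen I) (hc : I.OrdConnected)
    (hne : I.Nonempty) : ∃ a b : ℕ → ℝ, (∀ n, Icc (a n) (b n) ⊆ I) ∧
      (Monotone fun n => Icc (a n) (b n)) ∧ ⋃ n, Icc (a n) (b n) = I := by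
  have : Nonempty I := hne.to_subtype
  set d : ℕ → ℝ := fun n => (TopologicalSpace.denseSeq I n : ℝ) with hd
  have hdI : ∀ n, d n ∈ I := fun n => (TopologicalSpace.denseSeq I n).2
  have hdense : ∀ V : Set ℝ, IsOpen V → (I ∩ V).Nonempty → ∃ n, d n ∈ V := by
    rintro V hV ⟨x, hxI, hxV⟩
    obtain ⟨n, hn⟩ := (TopologicalSpace.denseRange_denseSeq I).exists_mem_open
      (hV.preimage continuous_subtype_val) ⟨⟨x, hxI⟩, hxV⟩
    exact ⟨n, hn⟩
  have hmin : ∀ n, ∃ i ≤ n, -(partialSups (fun k => -d k) n) = d i := by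
    intro n
    obtain ⟨i, hi, h⟩ := exists_partialSups_eq (fun k => -d k) n
    exact ⟨i, hi, by rw [h, neg_neg]⟩
  have hmax : ∀ n, ∃ i ≤ n, partialSups d n = d i := fun n => exists_partialSups_eq d n
  -- The endpoints are the running minimum and maximum of a dense sequence in `I`, which treats
  -- bounded and unbounded intervals alike.
  refine ⟨fun n => -(partialSups (fun k => -d k) n), fun n => partialSups d n, fun n => ?_,
    fun m n hmn => Icc_subset_Icc (neg_le_neg ((partialSups _).monotone hmn))
      ((partialSups _).monotone hmn), ?_⟩
  · obtain ⟨i, -, hi⟩ := hmin n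
    obtain ⟨j, -, hj⟩ := hmax n
    simp only [hi, hj]
    exact hc.out (hdI i) (hdI j)
  · apply Subset.antisymm
    · refine iUnion_subset fun n => ?_
      obtain ⟨i, -, hi⟩ := hmin n
      obtain ⟨j, -, hj⟩ := hmax n
      simp only [hi, hj]
      exact hc.out (hdI i) (hdI j)
    · intro x hx
      obtain ⟨l, u, ⟨hlx, hxu⟩, hlu⟩ := mem_nhds_iff_exists_Ioo_subset.1 (hI.mem_nhds hx)
      obtain ⟨i, hi⟩ := hdense (Iio x) isOpen_Iio (by
        obtain ⟨y, hy⟩ := exists_between hlx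
        exact ⟨y, hlu ⟨hy.1, hy.2.trans hxu⟩, hy.2⟩)
      obtain ⟨j, hj⟩ := hdense (Ioi x) isOpen_Ioi (by
        obtain ⟨y, hy⟩ := exists_between hxu
        exact ⟨y, hlu ⟨hlx.trans hy.1, hy.2⟩, hy.1⟩)
      refine mem_iUnion.2 ⟨max i j, ?_, ?_⟩
      · have := le_partialSups_of_le (fun k => -d k) (le_max_left i j)
        have hi' : d i < x := hi
        simp only at this ⊢
        linarith
      · have := le_partialSups_of_le d (le_max_right i j)
        exact (le_of_lt hj).trans this

section Density

variable {A : Set ℝ} {W : ℝ → ℝ} {α : ℝ} {μ : Measure ℝ} {g : ℝ → ℝ}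

/-- The localized logarithmic Sobolev inequality on a compact subinterval. -/
lemma logSobolev_density_Icc (hA : A.OrdConnected) (hW : ContDiffOn ℝ 2 W A) (hα : 0 < α)
    (hconv : ∀ x ∈ A, α ≤ iteratedDerivWithin 2 W A x) [IsFiniteMeasure μ]
    [SigmaFinite (gibbs W A)] (hac : μ ≪ gibbs W A)
    (hg : IsWeakDerivOn (fun x => √(density μ (gibbs W A) x)) g (interior A))
    (hg2 : IntegrableOn (fun x => g x ^ 2) A (gibbs W A)) {a b : ℝ} (hab : a < b)
    (hI : Icc a b ⊆ interior A) :
    IntegrableOn (fun x => density μ (gibbs W A) x * Real.log (density μ (gibbs W A) x))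
        (Icc a b) (gibbs W A) ∧
      ∫ x in Icc a b, density μ (gibbs W A) x * Real.log (density μ (gibbs W A) x) ∂(gibbs W A) ≤
        μ.real (Icc a b) * Real.log (μ.real (Icc a b) / (gibbs W A).real (Icc a b))
        + 2 / α * ∫ x in Icc a b, g x ^ 2 ∂(gibbs W A) := by
  set ν := gibbs W A with hν
  set f := density μ ν with hf
  have hIA : Icc a b ⊆ A := hI.trans interior_subset
  obtain ⟨hu, hgl, hweak⟩ := hg
  have hgi : IntervalIntegrable g volume a b := by
    rw [intervalIntegrable_iff_integrableOn_Icc_of_le hab.le]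
    exact hgl.integrableOn_compact_subset hI isCompact_Icc
  obtain ⟨c, hc⟩ := ae_eq_const_add_integral hab
    ((hu.integrableOn_compact_subset hI isCompact_Icc).mono_set Ioo_subset_Icc_self) hgi
    fun φ h1 h2 h3 => hweak φ h1 h2 (h3.trans (Ioo_subset_Icc_self.trans hI))
  set H : ℝ → ℝ := fun x => c + ∫ t in a..x, g t with hH
  have hHAC : AbsolutelyContinuousOnInterval H a b :=
    (LipschitzWith.const c).lipschitzOnWith.absolutelyContinuousOnInterval.add
      (hgi.absolutelyContinuousOnInterval_intervalIntegral (by simp))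
  have hHc : ContinuousOn H (Icc a b) := uIcc_of_le hab.le ▸ hHAC.continuousOn
  have hHu : ∀ᵐ x ∂(volume.restrict (Icc a b)), √(f x) = H x := by
    rw [← restrict_Ioo_eq_restrict_Icc, ae_restrict_iff' measurableSet_Ioo]
    exact hc
  -- `H = |H|` holds almost everywhere, hence everywhere by continuity.
  have hnn : ∀ x ∈ Icc a b, 0 ≤ H x := by
    have : EqOn H (fun x => |H x|) (Icc a b) := by
      refine Measure.eqOn_Icc_of_ae_eq volume hab.ne ?_ hHc hHc.abs
      filter_upwards [hHu] with x hx
      rw [← hx, abs_of_nonneg (Real.sqrt_nonneg _)]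
    intro x hx
    rw [this hx]
    exact abs_nonneg _
  have hfH : ∀ᵐ x ∂(volume.restrict (Icc a b)), f x = H x ^ 2 := by
    filter_upwards [hHu] with x hx
    rw [← hx]
    exact (Real.sq_sqrt ENNReal.toReal_nonneg).symm
  have hHg : ∀ᵐ x, x ∈ Icc a b → HasDerivAt H (g x) x := by
    filter_upwards [hgi.ae_hasDerivAt_integral] with x hx hxI
    exact (hx (uIcc_of_le hab.le ▸ hxI) a (by simp)).const_add c
  have hWd : ∀ x ∈ Icc a b, HasDerivAt W (deriv W x) x := fun x hx =>
    hasDerivAt_of_contDiffOn hW (hI hx)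
  have hW' : ContinuousOn (deriv W) (Icc a b) :=
    ((hW.mono interior_subset).continuousOn_deriv_of_isOpen isOpen_interior (by norm_num)).mono hI
  have hg2i : IntervalIntegrable (fun x => g x ^ 2 * Real.exp (-W x)) volume a b := by
    rw [intervalIntegrable_iff_integrableOn_Icc_of_le hab.le]
    exact (integrableOn_gibbs_iff hW measurableSet_Icc hIA).1 (hg2.mono_set hIA)
  have main := logSobolev_Icc hab hα hWd hW'
    (fun x hx y hy => tangent_parabola_le hA hW hconv (hI hx) (hI hy)) hHAC hHg hnn hg2i
  have hEc : ContinuousOn (fun x => Real.exp (-W x)) (Icc a b) :=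
    (hW.continuousOn.mono hIA).neg.rexp
  have hconvert : ∀ k : ℝ → ℝ, ∫ x in Icc a b, k (f x) ∂ν =
      ∫ x in a..b, k (H x ^ 2) * Real.exp (-W x) := by
    intro k
    rw [hν, setIntegral_gibbs hW measurableSet_Icc hIA, intervalIntegral.integral_of_le hab.le,
      ← integral_Icc_eq_integral_Ioc]
    apply integral_congr_ae
    filter_upwards [hfH] with x hx
    rw [hx]
  have hM : ∫ x in a..b, H x ^ 2 * Real.exp (-W x) = μ.real (Icc a b) := by
    rw [← hconvert fun t => t, ← Measure.setIntegral_toReal_rnDeriv hac (Icc a b)]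
    rfl
  have hN : ∫ x in a..b, Real.exp (-W x) = ν.real (Icc a b) := by
    have := hconvert fun _ => 1
    simp only [one_mul] at this
    rw [← this]
    simp
  have hG : ∫ x in a..b, g x ^ 2 * Real.exp (-W x) = ∫ x in Icc a b, g x ^ 2 ∂ν := by
    rw [hν, setIntegral_gibbs hW measurableSet_Icc hIA, intervalIntegral.integral_of_le hab.le,
      ← integral_Icc_eq_integral_Ioc]
  rw [hM, hN, hG, ← hconvert fun t => t * Real.log t] at main
  refine ⟨?_, main⟩
  rw [hν, integrableOn_gibbs_iff hW measurableSet_Icc hIA]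
  refine IntegrableOn.congr_fun_ae (f := fun x => H x ^ 2 * Real.log (H x ^ 2) *
    Real.exp (-W x)) ?_ ?_
  · exact ((Real.continuous_mul_log.comp_continuousOn (hHc.pow 2)).mul hEc).integrableOn_Icc
  · filter_upwards [hfH] with x hx
    rw [hx]

end Density

/-- Truncating negative values to zero loses nothing against a nonnegative bound. -/
lemma le_coe_ennreal_of_toENNReal_le {x : EReal} {y : ℝ≥0∞} (h : x.toENNReal ≤ y) :
    x ≤ (y : EReal) :=
  calc x ≤ max 0 x := le_max_right _ _
    _ = (x.toENNReal : EReal) := EReal.coe_toENNReal_eq_max.symm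
    _ ≤ y := EReal.coe_ennreal_le_coe_ennreal_iff.2 h

lemma extIntegral_eq_integral {h : ℝ → ℝ} {ν : Measure ℝ} {A : Set ℝ}
    (hh : IntegrableOn h A ν) : extIntegral h ν A = ((∫ x in A, h x ∂ν : ℝ) : EReal) := by
  have h1 : ∫⁻ x in A, ENNReal.ofReal (h x) ∂ν ≠ ⊤ := hh.lintegral_lt_top.ne
  have h2 : ∫⁻ x in A, ENNReal.ofReal (-h x) ∂ν ≠ ⊤ := hh.neg.lintegral_lt_top.ne
  rw [extIntegral, integral_eq_lintegral_pos_part_sub_lintegral_neg_part hh, EReal.coe_sub,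
    EReal.coe_ennreal_toReal h1, EReal.coe_ennreal_toReal h2]

lemma neg_one_le_mul_log {t : ℝ} (ht : 0 ≤ t) : -1 ≤ t * Real.log t := by
  rcases ht.eq_or_lt with rfl | h
  · simp
  · have h1 := mul_le_mul_of_nonneg_left (Real.one_sub_inv_le_log_of_pos h) ht
    rw [mul_sub, mul_inv_cancel₀ h.ne'] at h1
    linarith

lemma abs_le_add_two_of_neg_one_le {t : ℝ} (ht : -1 ≤ t) : |t| ≤ t + 2 :=
  abs_le.2 ⟨by linarith, by linarith⟩

section Exhaustion

variable {A : Set ℝ} {W : ℝ → ℝ} {α : ℝ} {μ : Measure ℝ} {g : ℝ → ℝ}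

/-- The logarithmic Sobolev inequality when the Fisher information is finite. -/
lemma logSobolev_density (hA : A.OrdConnected) (hW : ContDiffOn ℝ 2 W A) (hα : 0 < α)
    (hconv : ∀ x ∈ A, α ≤ iteratedDerivWithin 2 W A x) [IsFiniteMeasure μ]
    (hac : μ ≪ gibbs W A) (hne : (interior A).Nonempty)
    (hg : IsWeakDerivOn (fun x => √(density μ (gibbs W A) x)) g (interior A))
    (hg2 : IntegrableOn (fun x => g x ^ 2) A (gibbs W A)) :
    IntegrableOn (fun x => density μ (gibbs W A) x * Real.log (density μ (gibbs W A) x))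
        A (gibbs W A) ∧
      ∫ x in A, density μ (gibbs W A) x * Real.log (density μ (gibbs W A) x) ∂(gibbs W A) ≤
        μ.real A * Real.log (μ.real A / (gibbs W A).real A)
        + 2 / α * ∫ x in A, g x ^ 2 ∂(gibbs W A) := by
  have hfin : IsFiniteMeasure (gibbs W A) := isFiniteMeasure_gibbs hA hW hα hconv
  set ν := gibbs W A with hν
  set h : ℝ → ℝ := fun x => density μ ν x * Real.log (density μ ν x) with hh
  have hnull : ν (A \ interior A) = 0 := gibbs_absolutelyContinuous (volume_sdiff_interior hA)
  have hhlow : ∀ x, -1 ≤ h x := fun x => neg_one_le_mul_log ENNReal.toReal_nonneg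
  obtain ⟨a, b, hsub, hmono, hun⟩ := exists_Icc_exhaustion isOpen_interior hA.interior hne
  have hsubA : ∀ n, Icc (a n) (b n) ⊆ A := fun n => (hsub n).trans interior_subset
  have hlim : ∀ ρ : Measure ℝ, IsFiniteMeasure ρ → ρ (A \ interior A) = 0 →
      Filter.Tendsto (fun n => ρ.real (Icc (a n) (b n))) Filter.atTop (nhds (ρ.real A)) := by
    intro ρ _ hρ
    have h1 := tendsto_measure_iUnion_atTop (μ := ρ) hmono
    have h2 : ρ (interior A) = ρ A :=
      measure_eq_measure_of_null_sdiff interior_subset hρ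
    rw [hun, h2] at h1
    exact (ENNReal.tendsto_toReal (measure_ne_top ρ A)).comp h1
  have hN := hlim ν hfin hnull
  have hM := hlim μ inferInstance (hac hnull)
  have hNpos : 0 < ν.real A := by
    rw [measureReal_def]
    refine ENNReal.toReal_pos (fun h0 => ?_) (measure_ne_top ν A)
    have h1 := restrict_absolutelyContinuous_gibbs hA hW h0
    rw [Measure.restrict_apply_self] at h1
    exact (isOpen_interior.measure_pos volume hne).ne' (measure_mono_null interior_subset h1)
  -- The Fisher term is enlarged to all of `A`, so it no longer depends on `n`.
  have hcompact : ∀ n, IntegrableOn h (Icc (a n) (b n)) ν ∧ ∫ x in Icc (a n) (b n), h x ∂ν ≤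
      μ.real (Icc (a n) (b n)) * Real.log (μ.real (Icc (a n) (b n)) / ν.real (Icc (a n) (b n)))
        + 2 / α * ∫ x in A, g x ^ 2 ∂ν := by
    intro n
    have hmon : ∫ x in Icc (a n) (b n), g x ^ 2 ∂ν ≤ ∫ x in A, g x ^ 2 ∂ν :=
      setIntegral_mono_set hg2 (Filter.Eventually.of_forall fun x => sq_nonneg _)
        (hsubA n).eventuallyLE
    have hmon' := mul_le_mul_of_nonneg_left hmon (by positivity : 0 ≤ 2 / α)
    rcases lt_or_ge (a n) (b n) with hab | hab
    · obtain ⟨h1, h2⟩ := logSobolev_density_Icc hA hW hα hconv hac hg hg2 hab (hsub n)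
      exact ⟨h1, h2.trans (by linarith)⟩
    -- The first intervals of the exhaustion can be single points, which are null.
    · have hz : volume (Icc (a n) (b n)) = 0 := by simp [hab]
      have hνz : ν (Icc (a n) (b n)) = 0 := gibbs_absolutelyContinuous hz
      have hμz : μ (Icc (a n) (b n)) = 0 := hac hνz
      have hr : ν.restrict (Icc (a n) (b n)) = 0 := Measure.restrict_eq_zero.2 hνz
      have hg0 : 0 ≤ ∫ x in A, g x ^ 2 ∂ν := integral_nonneg fun x => sq_nonneg _
      refine ⟨by rw [IntegrableOn, hr]; exact integrable_zero_measure, ?_⟩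
      rw [hr, integral_zero_measure, measureReal_def, hμz]
      simp only [ENNReal.toReal_zero, zero_mul, zero_add]
      positivity
  have hCtend : Filter.Tendsto (fun n => μ.real (Icc (a n) (b n)) *
      Real.log (μ.real (Icc (a n) (b n)) / ν.real (Icc (a n) (b n)))
        + 2 / α * ∫ x in A, g x ^ 2 ∂ν) Filter.atTop
      (nhds (μ.real A * Real.log (μ.real A / ν.real A) + 2 / α * ∫ x in A, g x ^ 2 ∂ν)) := by
    refine Filter.Tendsto.add_const _ ?_
    rw [mul_log_div_eq hNpos.ne']
    refine Filter.Tendsto.congr' (f₁ := fun n => ν.real (Icc (a n) (b n)) *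
      (μ.real (Icc (a n) (b n)) / ν.real (Icc (a n) (b n)) *
        Real.log (μ.real (Icc (a n) (b n)) / ν.real (Icc (a n) (b n))))) ?_
      (hN.mul ((Real.continuous_mul_log.tendsto _).comp (hM.div hN hNpos.ne')))
    filter_upwards [hN.eventually_ne hNpos.ne'] with n hn
    rw [mul_log_div_eq hn]
  have hcover : AECover (ν.restrict A) Filter.atTop fun n => Icc (a n) (b n) := by
    refine ⟨?_, fun n => measurableSet_Icc⟩
    rw [ae_restrict_iff' hA.measurableSet]
    filter_upwards [measure_eq_zero_iff_ae_notMem.1 hnull] with x hx hxA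
    have hxI : x ∈ interior A := by
      by_contra hx'
      exact hx ⟨hxA, hx'⟩
    rw [← hun] at hxI
    obtain ⟨n, hn⟩ := mem_iUnion.1 hxI
    filter_upwards [Filter.eventually_ge_atTop n] with m hm
    exact hmono hm hn
  have hrr : ∀ n, (ν.restrict A).restrict (Icc (a n) (b n)) = ν.restrict (Icc (a n) (b n)) :=
    fun n => by rw [Measure.restrict_restrict measurableSet_Icc, inter_eq_left.2 (hsubA n)]
  -- Since `h ≥ -1`, one has `|h| ≤ h + 2`, so the upper bounds on `∫ h` become bounds in `L¹`.
  have hint : Integrable h (ν.restrict A) := by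
    refine hcover.integrable_of_integral_norm_bounded
      (μ.real A * Real.log (μ.real A / ν.real A) + 2 / α * ∫ x in A, g x ^ 2 ∂ν + 1
        + 2 * ν.real A) (fun n => by rw [IntegrableOn, hrr]; exact (hcompact n).1) ?_
    filter_upwards [hCtend.eventually_le_const (lt_add_one _)] with n hn
    rw [hrr]
    calc ∫ x in Icc (a n) (b n), ‖h x‖ ∂ν ≤ ∫ x in Icc (a n) (b n), (h x + 2) ∂ν :=
          integral_mono (hcompact n).1.norm ((hcompact n).1.add (integrable_const _))
            fun x => abs_le_add_two_of_neg_one_le (hhlow x)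
      _ = (∫ x in Icc (a n) (b n), h x ∂ν) + 2 * ν.real (Icc (a n) (b n)) := by
          rw [integral_add (hcompact n).1 (integrable_const _)]
          simp [mul_comm]
      _ ≤ _ := add_le_add ((hcompact n).2.trans hn)
          (mul_le_mul_of_nonneg_left (measureReal_mono (hsubA n)) (by norm_num))
  have htend := hcover.integral_tendsto_of_countably_generated hint
  simp only [hrr] at htend
  exact ⟨hint, le_of_tendsto_of_tendsto' htend hCtend fun n => (hcompact n).2⟩

end Exhaustion

lemma mul_relEntropy_le {A : Set ℝ} (hA : A.OrdConnected) {W : ℝ → ℝ}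
    (hW : ContDiffOn ℝ 2 W A) {α : ℝ} (hα : 0 < α)
    (hconv : ∀ x ∈ A, α ≤ iteratedDerivWithin 2 W A x) {μ : Measure ℝ} [IsFiniteMeasure μ]
    (hac : μ ≪ gibbs W A) {g : ℝ → ℝ}
    (hg : IsWeakDerivOn (fun x => √(density μ (gibbs W A) x)) g (interior A)) :
    (α : EReal) * relEntropy μ (gibbs W A) A ≤
      ((2 * ∫⁻ x in A, ENNReal.ofReal (|g x| ^ 2) ∂(gibbs W A) : ℝ≥0∞) : EReal) := by
  set ν := gibbs W A with hν
  rw [relEntropy, if_pos hac]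
  rcases (interior A).eq_empty_or_nonempty with he | hne
  · have hvol : volume A = 0 := by simpa [he] using volume_sdiff_interior hA
    have hνA : ν A = 0 := gibbs_absolutelyContinuous hvol
    have hμA : μ.real A = 0 := by rw [measureReal_def, hac hνA, ENNReal.toReal_zero]
    rw [extIntegral, Measure.restrict_eq_zero.2 hνA, hμA]
    simp
  by_cases htop : ∫⁻ x in A, ENNReal.ofReal (|g x| ^ 2) ∂ν = ⊤
  · rw [htop]
    simp
  -- The weak derivative is controlled only on the interior, which differs from `A` by a null set.
  have hgm : AEStronglyMeasurable g (ν.restrict A) := by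
    have h1 : AEStronglyMeasurable g (volume.restrict (interior A)) :=
      hg.2.1.aestronglyMeasurable
    have h2 : volume.restrict (interior A) = volume.restrict A :=
      Measure.restrict_congr_set <| (LE.le.eventuallyLE interior_subset).antisymm <|
        ae_le_set.2 (volume_sdiff_interior hA)
    rw [h2] at h1
    refine h1.mono_ac (Measure.restrict_le_self.absolutelyContinuous.trans ?_)
    exact withDensity_absolutelyContinuous _ _
  have hg2 : IntegrableOn (fun x => g x ^ 2) A ν := by
    refine ⟨hgm.pow 2, ?_⟩
    rw [hasFiniteIntegral_iff_ofReal (Filter.Eventually.of_forall fun x => sq_nonneg _)]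
    simpa only [sq_abs] using lt_top_iff_ne_top.2 htop
  obtain ⟨hint, hle⟩ := logSobolev_density hA hW hα hconv hac hne hg hg2
  have hlint : ∫⁻ x in A, ENNReal.ofReal (|g x| ^ 2) ∂ν =
      ENNReal.ofReal (∫ x in A, g x ^ 2 ∂ν) := by
    rw [ofReal_integral_eq_lintegral_ofReal hg2
      (Filter.Eventually.of_forall fun x => sq_nonneg _)]
    simp only [sq_abs]
  rw [extIntegral_eq_integral hint, hlint, ← EReal.coe_sub, ← EReal.coe_mul]
  refine le_coe_ennreal_of_toENNReal_le ?_
  rw [EReal.real_coe_toENNReal, ← ENNReal.ofReal_ofNat 2, ← ENNReal.ofReal_mul (by norm_num)]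
  refine ENNReal.ofReal_le_ofReal ?_
  have h1 := mul_le_mul_of_nonneg_left hle hα.le
  have h2 : α * (2 / α * ∫ x in A, g x ^ 2 ∂ν) = 2 * ∫ x in A, g x ^ 2 ∂ν := by
    field_simp
  linarith

end LocalizedLSI

theorem lemmal (A : Set ℝ) (hA : A.OrdConnected) (W : ℝ → ℝ) (hW : ContDiffOn ℝ 2 W A)
    (α : ℝ) (hα : 0 < α) (hconv : ∀ x ∈ A, α ≤ iteratedDerivWithin 2 W A x)
    (μ : Measure ℝ) [IsFiniteMeasure μ] (hμ : μ Aᶜ = 0) :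
    (α : EReal) * LocalizedLSI.relEntropy μ (LocalizedLSI.gibbs W A) A
      ≤ (LocalizedLSI.relFisher μ (LocalizedLSI.gibbs W A) A : EReal) := by
  rw [LocalizedLSI.relFisher]
  split_ifs with hac
  -- Passing to `ℝ≥0∞` places both sides where the infimum over weak derivatives is taken.
  · refine LocalizedLSI.le_coe_ennreal_of_toENNReal_le (le_iInf₂ fun g hg => ?_)
    have := EReal.toENNReal_le_toENNReal (LocalizedLSI.mul_relEntropy_le hA hW hα hconv hac hg)
    rwa [EReal.toENNReal_coe] at this
  · simp
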